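/- Let $\widetilde{\mathcal M}_6(\pi/3)$ be the set of hexagons $\mathcal P=(P_0,\dots,P_5)$ with $P_i\in\mathbb R^3$ (indices mod $6$; edges may intersect and vertices may coincide) such that $|P_i-P_{i+1}|=1$ and $\angle P_{i-1}P_iP_{i+1}=\pi/3$ for all $i$, topologized as a subspace of $(\mathbb R^3)^6$. Let $\mathcal M_6(\pi/3)=\widetilde{\mathcal M}_6(\pi/3)/G$ with the quotient topology, where $G$ is the group of orientation preserving isometries of $\mathbb R^3$, and write $[\mathcal P]$ for the class of $\mathcal P$. For real $\varphi_1,\varphi_3,\varphi_5$, put $S=\sin\frac{\pi}{6}=\frac12$ and $C=\cos\frac{\pi}{6}=\frac{\sqrt3}{2}$, and let $H(\varphi_1,\varphi_3,\varphi_5)$ be the hexagon with $$P_0=(-S,0,0),\quad P_2=(S,0,0),\quad P_4=(0,\sqrt3\,S,0),$$ $$P_1=(0,\,-C\cos\varphi_1,\,C\sin\varphi_1),$$ $$P_3=\left(\tfrac12S+\tfrac{\sqrt3}{2}C\cos\varphi_3,\ \tfrac{\sqrt3}{2}S+\tfrac12C\cos\varphi_3,\ C\sin\varphi_3\right),$$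 $$P_5=\left(-\tfrac12S-\tfrac{\sqrt3}{2}C\cos\varphi_5,\ \tfrac{\sqrt3}{2}S+\tfrac12C\cos\varphi_5,\ C\sin\varphi_5\right).$$ The *chair* is $H(\alpha,\alpha,\alpha)$ with $\alpha=\arccos\frac13$, and its mirror image is its reflection in the plane $z=0$. Let $X$ be the topological graph obtained from the $1$-skeleton of a tetrahedron by doubling every edge: it has four vertices $A,B,C,D$, and each of the six pairs of distinct vertices is joined by exactly two edges (twelve edges in all). **Statement.** There is a homeomorphism from $\mathcal M_6(\pi/3)$ onto the disjoint union (topological sum) of a pair of points and $X$, under which the two points correspond to the class of the chair and the class of its mirror image, and the vertices $A,B,C,D$ of $X$ correspond to the classes of $H(\pi,\pi,\pi)$, $H(\pi,\pi,0)$, $H(0,\pi,\pi)$, $H(\pi,0,\pi)$ respectively. These four hexagons are equilateral and $\frac{\pi}{3}$-equiangular as above, and each of them is planar. -/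

import Mathlib

open Real

noncomputable section

namespace Hexagons

/-- Euclidean three-space. -/
abbrev Space : Type := EuclideanSpace ℝ (Fin 3)

/-- The `θ`-equiangular unit equilateral `n`-gons in space; indices are taken modulo `n`. -/
def polygons (n : ℕ) [NeZero n] (θ : ℝ) : Set (Fin n → Space) :=
  {P | ∀ i : Fin n, dist (P i) (P (i + 1)) = 1 ∧
    EuclideanGeometry.angle (P (i - 1)) (P i) (P (i + 1)) = θ}

/-- The group of orientation preserving isometries of space. -/
def motionGroup : Subgroup (Space ≃ᵃⁱ[ℝ] Space) where
  carrier := {g | 0 < LinearMap.det (g.linearIsometryEquiv.toLinearEquiv : Space →ₗ[ℝ] Space)}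
  one_mem' := by
    have h : ((1 : Space ≃ᵃⁱ[ℝ] Space).linearIsometryEquiv.toLinearEquiv : Space →ₗ[ℝ] Space)
        = LinearMap.id := rfl
    simp only [Set.mem_ofPred_eq, h, LinearMap.det_id]
    exact one_pos
  mul_mem' := by
    intro a b ha hb
    have h : ((a * b).linearIsometryEquiv.toLinearEquiv : Space →ₗ[ℝ] Space)
        = (a.linearIsometryEquiv.toLinearEquiv : Space →ₗ[ℝ] Space) ∘ₗ
          (b.linearIsometryEquiv.toLinearEquiv : Space →ₗ[ℝ] Space) := rfl
    simp only [Set.mem_ofPred_eq] at ha hb ⊢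
    rw [h, LinearMap.det_comp]
    exact mul_pos ha hb
  inv_mem' := by
    intro a ha
    have h : (a.linearIsometryEquiv.toLinearEquiv : Space →ₗ[ℝ] Space) ∘ₗ
        (a⁻¹.linearIsometryEquiv.toLinearEquiv : Space →ₗ[ℝ] Space) = LinearMap.id := by
      ext1 x
      exact a.linearIsometryEquiv.apply_symm_apply x
    have h2 := congrArg LinearMap.det h
    rw [LinearMap.det_comp, LinearMap.det_id] at h2
    simp only [Set.mem_ofPred_eq] at ha ⊢
    by_contra hc
    have h3 := mul_nonpos_of_nonneg_of_nonpos ha.le (not_lt.mp hc)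
    linarith

/-- Two polygons are equivalent if an orientation preserving isometry of space carries the
vertices of the first, in order, to those of the second. -/
def polygonSetoid (n : ℕ) [NeZero n] (θ : ℝ) : Setoid (polygons n θ) where
  r P Q := ∃ g ∈ motionGroup, ∀ i, g (P.1 i) = Q.1 i
  iseqv :=
    { refl := fun _ => ⟨1, motionGroup.one_mem, fun _ => rfl⟩
      symm := by
        rintro P Q ⟨g, hg, h⟩
        refine ⟨g⁻¹, motionGroup.inv_mem hg, fun i => ?_⟩
        rw [← h i]
        exact g.symm_apply_apply _
      trans := by
        rintro P Q R ⟨g, hg, h⟩ ⟨k, hk, h'⟩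
        refine ⟨k * g, motionGroup.mul_mem hk hg, fun i => ?_⟩
        rw [← h' i, ← h i]
        rfl }

/-- The configuration space of `θ`-equiangular unit equilateral `n`-gons, with the quotient
topology. -/
def ConfigurationSpace (n : ℕ) [NeZero n] (θ : ℝ) : Type :=
  Quotient (polygonSetoid n θ)

instance (n : ℕ) [NeZero n] (θ : ℝ) : TopologicalSpace (ConfigurationSpace n θ) :=
  inferInstanceAs (TopologicalSpace (Quotient (polygonSetoid n θ)))

/-- `P` is a `θ`-equiangular unit equilateral polygon and `x` is its class. -/
def IsClassOf {n : ℕ} [NeZero n] {θ : ℝ} (x : ConfigurationSpace n θ) (P : Fin n → Space) : Prop :=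
  ∃ h : P ∈ polygons n θ, x = Quotient.mk (polygonSetoid n θ) ⟨P, h⟩

/-- The hexagon with `P₀, P₂, P₄` a fixed regular triangle of edge length `2 sin (θ/2)` in the
plane `z = 0`, and `P₁, P₃, P₅` on the circles of radius `cos (θ/2)` around the midpoints of its
edges, at the angles `φ₁, φ₃, φ₅` from the outward direction. -/
def hexagon (θ φ₁ φ₃ φ₅ : ℝ) : Fin 6 → Space :=
  let S := sin (θ / 2)
  let C := cos (θ / 2)
  ![!₂[-S, 0, 0],
    !₂[0, -(C * cos φ₁), C * sin φ₁],
    !₂[S, 0, 0],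
    !₂[S / 2 + √3 / 2 * C * cos φ₃, √3 / 2 * S + C * cos φ₃ / 2, C * sin φ₃],
    !₂[0, √3 * S, 0],
    !₂[-(S / 2) - √3 / 2 * C * cos φ₅, √3 / 2 * S + C * cos φ₅ / 2, C * sin φ₅]]

/-- The chair with bond angle `π / 3`. -/
def chair : Fin 6 → Space :=
  hexagon (π / 3) (arccos (1 / 3)) (arccos (1 / 3)) (arccos (1 / 3))

/-- The mirror image of a polygon in the plane `z = 0`. -/
def mirrorImage {n : ℕ} (P : Fin n → Space) : Fin n → Space :=
  fun i => !₂[P i 0, P i 1, -(P i 2)]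

/-- The four planar hexagons with bond angle `π / 3`. -/
def planarHexagon : Fin 4 → Fin 6 → Space :=
  ![hexagon (π / 3) π π π, hexagon (π / 3) π π 0, hexagon (π / 3) 0 π π, hexagon (π / 3) π 0 π]

/-- The edges of the tetrahedron with vertices `0, 1, 2, 3`, each taken twice. -/
abbrev DoubledEdge : Type := {p : Fin 4 × Fin 4 // p.1 < p.2} × Fin 2

/-- The two ends of every edge are glued to the vertices of that edge. -/
inductive Glue : Fin 4 ⊕ (DoubledEdge × unitInterval) → Fin 4 ⊕ (DoubledEdge × unitInterval) → Prop
  | source (ε : DoubledEdge) : Glue (Sum.inr (ε, 0)) (Sum.inl ε.1.1.1)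
  | target (ε : DoubledEdge) : Glue (Sum.inr (ε, 1)) (Sum.inl ε.1.1.2)

/-- The topological space of the 1-skeleton of a tetrahedron with every edge doubled: the
quotient of the disjoint union of four points and twelve unit intervals by the equivalence
relation that `Glue` generates, with the quotient topology. -/
def DoubledTetrahedron : Type := Quot Glue

instance : TopologicalSpace DoubledTetrahedron :=
  inferInstanceAs (TopologicalSpace (Quot Glue))

/-- The vertices of the doubled 1-skeleton. -/
def DoubledTetrahedron.vertex (v : Fin 4) : DoubledTetrahedron := Quot.mk Glue (Sum.inl v)

end Hexagons

end

noncomputable section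

namespace Hexagons

/-! With unit edges, bond angle `π / 3` means that all short diagonals have length one. Hence `P₀ P₂
P₄` is a unit triangle, which a unique motion brings to a standard position, and `P₅, P₁, P₃` move
on circles about its edges, with fold angles `φ₁, φ₂, φ₃` in the numbering of `bentHexagon`. What
remains is that these three points are at mutual distance one. In terms of `t = tan (φ / 2)` this
says, for each pair, that one of the two angles is `π` or `2 t t' = 1`
(`bentHexagon_mem_polygons_iff`).

Write `t = ±(1 - w) / (√2 w)` with `w ∈ [0, 1]`, so that `φ = π` is `w = 0`. Each pair must then
satisfy: one weight is zero, or the signs agree and the weights add up to one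
(`compatible_fold_iff`, `compatible_weights`). Three nonzero weights are all `1 / 2`, with one
common sign: the chair and its mirror image. Otherwise put `w₀ = 1 - w₁ - w₂ - w₃`; the weights
become barycentric coordinates on the 1-skeleton of a tetrahedron. The sign doubles each open edge
and is lost at the vertices, where every sine vanishes.

Long diagonals and oriented volumes are continuous invariants that recover the fold angles. They
make the parametrization injective and the configuration space Hausdorff, so a continuous bijection
from a compact space is a homeomorphism. -/

/-! ### Reduction of the angle conditions to distances -/

theorem dist_eq_one_iff (p q : Space) :
    dist p q = 1 ↔ (p 0 - q 0) ^ 2 + (p 1 - q 1) ^ 2 + (p 2 - q 2) ^ 2 = 1 := by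
  rw [EuclideanSpace.dist_eq, Real.sqrt_eq_one, Fin.sum_univ_three]
  simp only [Real.dist_eq, sq_abs]

theorem angle_eq_pi_div_three_iff {p q r : Space} (hp : dist p q = 1) (hr : dist q r = 1) :
    EuclideanGeometry.angle p q r = π / 3 ↔ dist p r = 1 := by
  have h := EuclideanGeometry.law_cos p q r
  rw [hp, dist_comm r q, hr] at h
  constructor
  · intro ha
    rw [ha, cos_pi_div_three] at h
    nlinarith [dist_nonneg (x := p) (y := r)]
  · intro hd
    rw [hd] at h
    refine injOn_cos ⟨EuclideanGeometry.angle_nonneg _ _ _, EuclideanGeometry.angle_le_pi _ _ _⟩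
      ⟨by positivity, by linarith [pi_pos]⟩ ?_
    rw [cos_pi_div_three]
    linarith

theorem mem_polygons_iff {n : ℕ} [NeZero n] (P : Fin n → Space) :
    P ∈ polygons n (π / 3) ↔
      ∀ i, dist (P i) (P (i + 1)) = 1 ∧ dist (P (i - 1)) (P (i + 1)) = 1 := by
  constructor
  · intro h i
    refine ⟨(h i).1, (angle_eq_pi_div_three_iff ?_ (h i).1).1 (h i).2⟩
    simpa using (h (i - 1)).1
  · intro h i
    refine ⟨(h i).1, (angle_eq_pi_div_three_iff ?_ (h i).1).2 (h i).2⟩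
    simpa using (h (i - 1)).1

/-- The hexagon with `P₀, P₂, P₄` a fixed regular triangle of edge length one, and `P₅, P₁, P₃`
at the points `(c 1, s 1)`, `(c 2, s 2)`, `(c 3, s 3)` of the circles around the midpoints of its
edges. -/
def bentHexagon (c s : Fin 4 → ℝ) : Fin 6 → Space :=
  ![!₂[-1 / 2, 0, 0],
    !₂[0, -(√3 / 2 * c 2), √3 / 2 * s 2],
    !₂[1 / 2, 0, 0],
    !₂[1 / 4 + 3 / 4 * c 3, √3 / 4 + √3 / 4 * c 3, √3 / 2 * s 3],
    !₂[0, √3 / 2, 0],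
    !₂[-(1 / 4) - 3 / 4 * c 1, √3 / 4 + √3 / 4 * c 1, √3 / 2 * s 1]]

theorem hexagon_eq_bentHexagon {φ₁ φ₃ φ₅ : ℝ} {c s : Fin 4 → ℝ}
    (hc₁ : cos φ₅ = c 1) (hc₂ : cos φ₁ = c 2) (hc₃ : cos φ₃ = c 3)
    (hs₁ : sin φ₅ = s 1) (hs₂ : sin φ₁ = s 2) (hs₃ : sin φ₃ = s 3) :
    hexagon (π / 3) φ₁ φ₃ φ₅ = bentHexagon c s := by
  have h : π / 3 / 2 = π / 6 := by ring
  have h3 : √3 * √3 = 3 := by norm_num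
  unfold hexagon bentHexagon
  simp only [h, sin_pi_div_six, cos_pi_div_six, hc₁, hc₂, hc₃, hs₁, hs₂, hs₃]
  have e1 : √3 / 2 * (√3 / 2) = 3 / 4 := by linarith
  simp only [e1]
  ring_nf

/-- The condition that the vertices on two of the circles have distance one. -/
def Compatible (c s : Fin 4 → ℝ) (l m : Fin 4) : Prop :=
  2 * (s l * s m) = (1 + c l) * (1 + c m)

theorem bentHexagon_mem_polygons_iff {c s : Fin 4 → ℝ} (h₁ : c 1 ^ 2 + s 1 ^ 2 = 1)
    (h₂ : c 2 ^ 2 + s 2 ^ 2 = 1) (h₃ : c 3 ^ 2 + s 3 ^ 2 = 1) :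
    bentHexagon c s ∈ polygons 6 (π / 3) ↔
      Compatible c s 1 2 ∧ Compatible c s 1 3 ∧ Compatible c s 2 3 := by
  have h3 : √3 ^ 2 = 3 := by norm_num
  rw [mem_polygons_iff]
  simp only [Fin.forall_fin_succ, IsEmpty.forall_iff, dist_eq_one_iff, Compatible]
  simp [bentHexagon, show (-1 : Fin 6) = 5 by rfl, show (2 : Fin 6) + 1 = 3 by rfl,
    show (3 : Fin 6) + 1 = 4 by rfl, show (4 : Fin 6) + 1 = 5 by rfl,
    show (5 : Fin 6) + 1 = 0 by rfl, show (2 : Fin 6) - 1 = 1 by rfl,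
    show (3 : Fin 6) - 1 = 2 by rfl, show (4 : Fin 6) - 1 = 3 by rfl,
    show (5 : Fin 6) - 1 = 4 by rfl]
  constructor
  -- Only the diagonals `P₅P₁`, `P₁P₃`, `P₃P₅` carry information; the other conditions hold on the
  -- circles.
  · rintro ⟨⟨-, h12⟩, -, ⟨-, h23⟩, -, ⟨-, h13⟩, -⟩
    refine ⟨?_, ?_, ?_⟩
    · linear_combination (-4 / 3) * h12 + h₁ + h₂ +
        (4 / 3) * (((1 + c 1) / 4 + c 2 / 2) ^ 2 + (s 1 - s 2) ^ 2 / 4) * h3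
    · linear_combination (-4 / 3) * h13 + h₁ + h₃ +
        (4 / 3) * ((c 3 - c 1) ^ 2 / 16 + (s 1 - s 3) ^ 2 / 4) * h3
    · linear_combination (-4 / 3) * h23 + h₂ + h₃ +
        (4 / 3) * (((1 + c 3) / 4 + c 2 / 2) ^ 2 + (s 2 - s 3) ^ 2 / 4) * h3
  · rintro ⟨h12, h13, h23⟩
    refine ⟨⟨?_, ?_⟩, ⟨?_, ?_⟩, ⟨?_, ?_⟩, ⟨?_, ?_⟩, ⟨?_, ?_⟩, ?_, ?_⟩
    · linear_combination 3 / 4 * h₂ + (c 2 ^ 2 + s 2 ^ 2) / 4 * h3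
    · linear_combination (-3 / 4) * h12 + 3 / 4 * h₁ + 3 / 4 * h₂ +
        (((1 + c 1) / 4 + c 2 / 2) ^ 2 + (s 1 - s 2) ^ 2 / 4) * h3
    · linear_combination 3 / 4 * h₂ + (c 2 ^ 2 + s 2 ^ 2) / 4 * h3
    · norm_num
    · linear_combination 3 / 4 * h₃ + ((1 + c 3) ^ 2 / 16 + s 3 ^ 2 / 4) * h3
    · linear_combination (-3 / 4) * h23 + 3 / 4 * h₂ + 3 / 4 * h₃ +
        (((1 + c 3) / 4 + c 2 / 2) ^ 2 + (s 2 - s 3) ^ 2 / 4) * h3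
    · linear_combination 3 / 4 * h₃ + ((c 3 - 1) ^ 2 / 16 + s 3 ^ 2 / 4) * h3
    · linear_combination 1 / 4 * h3
    · linear_combination 3 / 4 * h₁ + ((c 1 - 1) ^ 2 / 16 + s 1 ^ 2 / 4) * h3
    · linear_combination (-3 / 4) * h13 + 3 / 4 * h₁ + 3 / 4 * h₃ +
        ((c 3 - c 1) ^ 2 / 16 + (s 1 - s 3) ^ 2 / 4) * h3
    · linear_combination 3 / 4 * h₁ + ((1 + c 1) ^ 2 / 16 + s 1 ^ 2 / 4) * h3
    · linear_combination 1 / 4 * h3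

/-! ### Normal form under orientation preserving motions -/

theorem exists_orthonormalBasis_extending {u v : Space} (hu : ‖u‖ = 1) (hv : ‖v‖ = 1)
    (huv : inner ℝ u v = 0) : ∃ b : OrthonormalBasis (Fin 3) ℝ Space, b 0 = u ∧ b 1 = v := by
  have h : Orthonormal ℝ (({0, 1} : Set (Fin 3)).domRestrict ![u, v, 0]) := by
    rw [orthonormal_iff_ite]
    rintro ⟨i, rfl | rfl⟩ ⟨j, rfl | rfl⟩ <;>
      simp [hu, hv, huv, real_inner_comm u v, Set.domRestrict, Subtype.ext_iff]
  obtain ⟨b, hb⟩ := h.exists_orthonormalBasis_extension_of_card_eq (by simp)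
  exact ⟨b, by simpa using hb 0 (by simp), by simpa using hb 1 (by simp)⟩

theorem exists_linearIsometryEquiv_det_pos {u v : Space} (hu : ‖u‖ = 1) (hv : ‖v‖ = 1)
    (huv : inner ℝ u v = 0) : ∃ L : Space ≃ₗᵢ[ℝ] Space,
      0 < LinearMap.det (L.toLinearEquiv : Space →ₗ[ℝ] Space) ∧
      L u = !₂[1, 0, 0] ∧ L v = !₂[0, 1, 0] := by
  obtain ⟨b, rfl, rfl⟩ := exists_orthonormalBasis_extending hu hv huv
  have h0 : b.repr (b 0) = !₂[1, 0, 0] := by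
    ext i; fin_cases i <;> simp
  have h1 : b.repr (b 1) = !₂[0, 1, 0] := by
    ext i; fin_cases i <;> simp
  rcases lt_or_ge 0 (LinearMap.det (b.repr.toLinearEquiv : Space →ₗ[ℝ] Space)) with hd | hd
  · exact ⟨b.repr, hd, h0, h1⟩
  · have hd' := hd.lt_of_ne (LinearEquiv.isUnit_det' b.repr.toLinearEquiv).ne_zero
    -- The reflection in `z = 0` fixes the first two basis vectors and changes the sign of the
    -- determinant.
    let K : Submodule ℝ Space := (ℝ ∙ (!₂[0, 0, 1] : Space))ᗮ
    have hK : LinearMap.det (K.reflection.toLinearEquiv : Space →ₗ[ℝ] Space) = -1 := by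
      rw [show (K.reflection.toLinearEquiv : Space →ₗ[ℝ] Space) =
        K.reflection.toLinearMap from rfl, Submodule.det_reflection,
        Submodule.orthogonal_orthogonal, finrank_span_singleton, pow_one]
      intro h
      simpa using congrArg (fun x : Space => x 2) h
    refine ⟨b.repr.trans K.reflection, ?_, ?_, ?_⟩
    · rw [show ((b.repr.trans K.reflection).toLinearEquiv : Space →ₗ[ℝ] Space) =
        (K.reflection.toLinearEquiv : Space →ₗ[ℝ] Space) ∘ₗ
          (b.repr.toLinearEquiv : Space →ₗ[ℝ] Space) from rfl, LinearMap.det_comp, hK]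
      linarith
    · rw [LinearIsometryEquiv.trans_apply, h0]
      exact Submodule.reflection_mem_subspace_eq_self
        (Submodule.mem_orthogonal_singleton_iff_inner_right.2
          (by simp [PiLp.inner_apply, Fin.sum_univ_three]))
    · rw [LinearIsometryEquiv.trans_apply, h1]
      exact Submodule.reflection_mem_subspace_eq_self
        (Submodule.mem_orthogonal_singleton_iff_inner_right.2
          (by simp [PiLp.inner_apply, Fin.sum_univ_three]))

theorem exists_motion_of_triangle {p q r : Space} (hpq : dist p q = 1) (hpr : dist p r = 1)
    (hqr : dist q r = 1) :
    ∃ g ∈ motionGroup, g p = !₂[-1 / 2, 0, 0] ∧ g q = !₂[1 / 2, 0, 0] ∧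
      g r = !₂[0, √3 / 2, 0] := by
  have h3 : √3 * √3 = 3 := by norm_num
  have h3' : √3 ≠ 0 := by positivity
  set u := q - p with hu
  set w := r - p with hw
  have nu : inner ℝ u u = 1 := by
    rw [real_inner_self_eq_norm_sq, hu, ← dist_eq_norm, dist_comm, hpq, one_pow]
  have nw : inner ℝ w w = 1 := by
    rw [real_inner_self_eq_norm_sq, hw, ← dist_eq_norm, dist_comm, hpr, one_pow]
  have nuw : inner ℝ u w = 1 / 2 := by
    have h : inner ℝ (u - w) (u - w) = 1 := by
      rw [real_inner_self_eq_norm_sq, hu, hw, sub_sub_sub_cancel_right, ← dist_eq_norm, hqr,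
        one_pow]
    rw [real_inner_sub_sub_self, nu, nw] at h
    linarith
  -- This vector is the normalized altitude of the triangle, orthogonal to `u`.
  have hv : inner ℝ ((2 / √3) • w - (1 / √3) • u) ((2 / √3) • w - (1 / √3) • u) = 1 := by
    simp only [inner_sub_left, inner_sub_right, real_inner_smul_left, real_inner_smul_right, nu,
      nw, nuw, real_inner_comm u w]
    field_simp
    nlinarith
  obtain ⟨L, hL, hLu, hLv⟩ := exists_linearIsometryEquiv_det_pos
    (u := u) (v := (2 / √3) • w - (1 / √3) • u)
    (by rw [norm_eq_sqrt_real_inner, nu, sqrt_one]) (by rw [norm_eq_sqrt_real_inner, hv, sqrt_one])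
    (by
      simp only [inner_sub_right, real_inner_smul_right, nu, nuw]
      field_simp
      norm_num)
  have hLw : L w = (√3 / 2) • !₂[0, 1, 0] + (1 / 2 : ℝ) • !₂[1, 0, 0] := by
    rw [← hLv, ← hLu, ← map_smul, ← map_smul, ← map_add]
    congr 1
    rw [smul_sub, smul_smul, smul_smul]
    field_simp
    module
  refine ⟨L.toAffineIsometryEquiv.trans
    (AffineIsometryEquiv.constVAdd ℝ Space (!₂[-1 / 2, 0, 0] - L p)), ?_, ?_, ?_, ?_⟩
  · exact hL
  · simp
  · have : L q = L u + L p := by rw [← map_add, hu, sub_add_cancel]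
    ext i
    fin_cases i <;> simp [this, hLu] <;> norm_num
  · have : L r = L w + L p := by rw [← map_add, hw, sub_add_cancel]
    ext i
    fin_cases i <;> simp [this, hLw] <;> ring

theorem exists_motion_eq_bentHexagon {P : Fin 6 → Space} (hP : P ∈ polygons 6 (π / 3)) :
    ∃ c s : Fin 4 → ℝ, (∀ l, c l ^ 2 + s l ^ 2 = 1) ∧
      ∃ g ∈ motionGroup, ∀ i, g (P i) = bentHexagon c s i := by
  have h3 : √3 ^ 2 = 3 := by norm_num
  have h30 : √3 ≠ 0 := by positivity
  rw [mem_polygons_iff] at hP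
  obtain ⟨g, hg, h0, h2, h4⟩ := exists_motion_of_triangle (hP 1).2
    (by rw [dist_comm]; exact (hP 5).2) (hP 3).2
  change g (P 0) = _ at h0
  change g (P 2) = _ at h2
  change g (P 4) = _ at h4
  have d01 : dist (g (P 0)) (g (P 1)) = 1 := by rw [g.dist_map]; exact (hP 0).1
  have d12 : dist (g (P 1)) (g (P 2)) = 1 := by rw [g.dist_map]; exact (hP 1).1
  have d23 : dist (g (P 2)) (g (P 3)) = 1 := by rw [g.dist_map]; exact (hP 2).1
  have d34 : dist (g (P 3)) (g (P 4)) = 1 := by rw [g.dist_map]; exact (hP 3).1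
  have d45 : dist (g (P 4)) (g (P 5)) = 1 := by rw [g.dist_map]; exact (hP 4).1
  have d50 : dist (g (P 5)) (g (P 0)) = 1 := by rw [g.dist_map]; exact (hP 5).1
  rw [dist_eq_one_iff] at d01 d12 d23 d34 d45 d50
  simp only [h0, h2, h4, Fin.isValue, PiLp.toLp_apply, Matrix.cons_val_zero, Matrix.cons_val_one,
    Matrix.cons_val] at d01 d12 d23 d34 d45 d50
  set q := g (P 1) with hq
  set r := g (P 3) with hr
  set t := g (P 5) with ht
  -- Equal distances to the ends of a triangle edge put each apex in the bisecting plane of that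
  -- edge.
  have hq0 : q 0 = 0 := by linear_combination (d01 - d12) / 2
  have hr1 : √3 * r 1 = r 0 + 1 / 2 := by linear_combination d23 - d34 + h3 / 4
  have ht1 : √3 * t 1 = 1 / 2 - t 0 := by linear_combination d50 - d45 + h3 / 4
  have hr1' : 3 * r 1 ^ 2 = (r 0 + 1 / 2) ^ 2 := by rw [← hr1, mul_pow, h3]
  have ht1' : 3 * t 1 ^ 2 = (1 / 2 - t 0) ^ 2 := by rw [← ht1, mul_pow, h3]
  -- Index `0` has no circle; its entry `(1, 0)` is a filler on the unit circle. The others invert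
  -- the formulas of `bentHexagon`.
  refine ⟨![1, -(4 / 3 * (t 0 + 1 / 4)), -(2 / √3 * q 1), 4 / 3 * (r 0 - 1 / 4)],
    ![0, 2 / √3 * t 2, 2 / √3 * q 2, 2 / √3 * r 2], ?_, g, hg, ?_⟩
  · intro l
    fin_cases l <;> simp [mul_pow, div_pow]
    · linear_combination 4 / 3 * d50 - 4 / 9 * ht1'
    · linear_combination 4 / 3 * d01 - 4 / 3 * (1 + q 0) * hq0
    · linear_combination 4 / 3 * d23 - 4 / 9 * hr1'
  · intro i
    fin_cases i
    · exact h0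
    · ext j
      fin_cases j <;> simp [bentHexagon, ← hq, hq0] <;> field_simp
    · exact h2
    · ext j
      fin_cases j <;> simp [bentHexagon, ← hr]
      · ring
      · linear_combination √3 / 3 * hr1 - r 1 / 3 * h3
      · field_simp
    · exact h4
    · ext j
      fin_cases j <;> simp [bentHexagon, ← ht]
      · ring
      · linear_combination √3 / 3 * ht1 - t 1 / 3 * h3
      · field_simp

/-! ### Continuous invariants of the motion group -/

/-- The index of the vertex that folds over the `l`-th edge of the triangle `P₀ P₂ P₄`. -/
def apex : Fin 4 → Fin 6 := ![0, 5, 1, 3]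

/-- The cosines of the fold angles, in terms of the lengths of the long diagonals. -/
def cosInvariant (P : Fin 6 → Space) (l : Fin 4) : ℝ :=
  2 / 3 * dist (P (apex l)) (P (apex l + 3)) ^ 2 - 1

/-- The sines of the fold angles, in terms of oriented volumes. -/
def sinInvariant (P : Fin 6 → Space) (l : Fin 4) : ℝ :=
  4 / 3 * (EuclideanSpace.basisFun (Fin 3) ℝ).toBasis.det
    ![P 2 - P 0, P 4 - P 0, P (apex l) - P 0]

theorem cosInvariant_motion (g : Space ≃ᵃⁱ[ℝ] Space) (P : Fin 6 → Space) :
    cosInvariant (fun i => g (P i)) = cosInvariant P := by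
  ext l
  simp only [cosInvariant, g.dist_map]

theorem det_eq_one_of_mem_motionGroup {g : Space ≃ᵃⁱ[ℝ] Space} (hg : g ∈ motionGroup) :
    LinearMap.det (g.linearIsometryEquiv.toLinearEquiv : Space →ₗ[ℝ] Space) = 1 := by
  have h := g.linearIsometryEquiv.toLinearIsometry.normDet_eq_one
  rw [LinearMap.normDet_eq_abs_det] at h
  rwa [← abs_of_pos (show 0 < LinearMap.det
    (g.linearIsometryEquiv.toLinearEquiv : Space →ₗ[ℝ] Space) from hg)]

theorem sinInvariant_motion {g : Space ≃ᵃⁱ[ℝ] Space} (hg : g ∈ motionGroup) (P : Fin 6 → Space) :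
    sinInvariant (fun i => g (P i)) = sinInvariant P := by
  ext l
  have h : ![g (P 2) - g (P 0), g (P 4) - g (P 0), g (P (apex l)) - g (P 0)] =
      (g.linearIsometryEquiv.toLinearEquiv : Space →ₗ[ℝ] Space) ∘
        ![P 2 - P 0, P 4 - P 0, P (apex l) - P 0] := by
    have hsub (x y : Space) : g x - g y = g.linearIsometryEquiv (x - y) :=
      (g.map_vsub x y).symm
    ext i : 1
    fin_cases i <;> exact hsub _ _
  simp only [sinInvariant]
  rw [h, Module.Basis.det_comp, det_eq_one_of_mem_motionGroup hg, one_mul]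

theorem continuous_cosInvariant : Continuous cosInvariant := by
  unfold cosInvariant
  fun_prop

theorem continuous_sinInvariant : Continuous sinInvariant := by
  refine continuous_pi fun l => ?_
  simp only [sinInvariant, Module.Basis.det_apply, Matrix.det_fin_three, Module.Basis.toMatrix_apply,
    OrthonormalBasis.coe_toBasis_repr_apply, EuclideanSpace.basisFun_repr]
  simp only [Matrix.cons_val_zero, Matrix.cons_val_one, Matrix.cons_val, PiLp.sub_apply]
  fun_prop

/-- Apex and opposite triangle vertex both lie at distance `√3 / 2` from the midpoint of the edge,
so the squared long diagonal is `3 / 2 * (1 + c l)`. -/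
theorem cosInvariant_bentHexagon {c s : Fin 4 → ℝ} {l : Fin 4} (hl : l ≠ 0)
    (h : c l ^ 2 + s l ^ 2 = 1) : cosInvariant (bentHexagon c s) l = c l := by
  have h3 : √3 ^ 2 = 3 := by norm_num
  simp only [cosInvariant, EuclideanSpace.dist_eq, Fin.sum_univ_three, Real.dist_eq, sq_abs]
  rw [sq_sqrt (by positivity)]
  fin_cases l
  · exact absurd rfl hl
  · simp [apex, bentHexagon, show (5 + 3 : Fin 6) = 2 by rfl] at h ⊢
    linear_combination h / 2 + ((1 + c 1) ^ 2 / 16 + s 1 ^ 2 / 4) * h3 * (2 / 3)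
  · simp [apex, bentHexagon, show (1 + 3 : Fin 6) = 4 by rfl] at h ⊢
    linear_combination h / 2 + ((1 + c 2) ^ 2 / 4 + s 2 ^ 2 / 4) * h3 * (2 / 3)
  · simp [apex, bentHexagon, show (3 + 3 : Fin 6) = 0 by rfl] at h ⊢
    linear_combination h / 2 + ((1 + c 3) ^ 2 / 16 + s 3 ^ 2 / 4) * h3 * (2 / 3)

/-- The determinant is twice the triangle's area, `√3 / 2`, times the apex height `√3 / 2 * s l`. -/
theorem sinInvariant_bentHexagon (c s : Fin 4 → ℝ) {l : Fin 4} (hl : l ≠ 0) :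
    sinInvariant (bentHexagon c s) l = s l := by
  have h3 : √3 ^ 2 = 3 := by norm_num
  simp only [sinInvariant, Module.Basis.det_apply, Matrix.det_fin_three,
    Module.Basis.toMatrix_apply, OrthonormalBasis.coe_toBasis_repr_apply,
    EuclideanSpace.basisFun_repr]
  fin_cases l
  · exact absurd rfl hl
  all_goals
    simp [apex, bentHexagon]
    ring_nf
    rw [h3]
    ring

/-- The invariants of a class of hexagons under motions. -/
def invariants : ConfigurationSpace 6 (π / 3) → (Fin 4 → ℝ) × (Fin 4 → ℝ) :=
  Quotient.lift (fun P => (cosInvariant P.1, sinInvariant P.1)) (by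
    rintro P Q ⟨g, hg, h⟩
    have hQ : Q.1 = fun i => g (P.1 i) := funext fun i => (h i).symm
    simp only [hQ, cosInvariant_motion, sinInvariant_motion hg])

theorem continuous_invariants : Continuous invariants :=
  ((continuous_cosInvariant.comp continuous_subtype_val).prodMk
    (continuous_sinInvariant.comp continuous_subtype_val)).quotient_lift _

theorem coplanar_of_third_coordinate_eq_zero {P : Set Space} (h : ∀ p ∈ P, p 2 = 0) :
    Coplanar ℝ P := by
  rw [coplanar_iff_finrank_le_two]
  have hle : vectorSpan ℝ P ≤ LinearMap.ker (EuclideanSpace.proj (2 : Fin 3) :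
      Space →L[ℝ] ℝ).toLinearMap := by
    rw [vectorSpan, Submodule.span_le]
    rintro _ ⟨p, hp, q, hq, rfl⟩
    simp [h p hp, h q hq]
  have hne : vectorSpan ℝ P ≠ ⊤ := by
    intro htop
    have : (EuclideanSpace.single 2 1 : Space) ∈ vectorSpan ℝ P := htop ▸ Submodule.mem_top
    simpa using hle this
  have := Submodule.finrank_lt hne
  rw [finrank_euclideanSpace_fin] at this
  omega

/-! ### Rational parametrization of the fold angles -/

/-- The cosine of the fold angle whose half-angle tangent is `±(1 - w) / (√2 w)`. -/
def foldCos (w : ℝ) : ℝ := (2 * w ^ 2 - (1 - w) ^ 2) / (2 * w ^ 2 + (1 - w) ^ 2)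

/-- The sine of the fold angle whose half-angle tangent is `g (1 - w) / (√2 w)`, for a sign
`g`. -/
def foldSin (g w : ℝ) : ℝ := g * (2 * √2 * (w * (1 - w)) / (2 * w ^ 2 + (1 - w) ^ 2))

theorem fold_denominator_pos (w : ℝ) : 0 < 2 * w ^ 2 + (1 - w) ^ 2 := by
  nlinarith [sq_nonneg (3 * w - 1)]

theorem foldCos_sq_add_foldSin_sq {g : ℝ} (hg : g ^ 2 = 1) (w : ℝ) :
    foldCos w ^ 2 + foldSin g w ^ 2 = 1 := by
  have h := (fold_denominator_pos w).ne'
  have h2 : √2 ^ 2 = 2 := by norm_num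
  simp only [foldCos, foldSin, mul_pow, div_pow, hg, h2]
  field_simp
  ring

/-- Away from angle `π`, compatibility is `2 t t' = 1` for the half-angle tangents; the `√2` in
their definition absorbs the factor two. -/
theorem compatible_fold_iff {g w : Fin 4 → ℝ} {l m : Fin 4} :
    Compatible (fun i => foldCos (w i)) (fun i => foldSin (g i) (w i)) l m ↔
      w l * w m * (g l * g m * (1 - w l) * (1 - w m) - w l * w m) = 0 := by
  have hl := (fold_denominator_pos (w l)).ne'
  have hm := (fold_denominator_pos (w m)).ne'
  have h2 : √2 * √2 = 2 := by norm_num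
  have e : 2 * (foldSin (g l) (w l) * foldSin (g m) (w m)) -
      (1 + foldCos (w l)) * (1 + foldCos (w m)) =
      16 * (w l * w m * (g l * g m * (1 - w l) * (1 - w m) - w l * w m)) /
        ((2 * w l ^ 2 + (1 - w l) ^ 2) * (2 * w m ^ 2 + (1 - w m) ^ 2)) := by
    have es : foldSin (g l) (w l) * foldSin (g m) (w m) =
        8 * (g l * g m * (w l * (1 - w l)) * (w m * (1 - w m))) /
        ((2 * w l ^ 2 + (1 - w l) ^ 2) * (2 * w m ^ 2 + (1 - w m) ^ 2)) := by
      rw [foldSin, foldSin, eq_div_iff (mul_ne_zero hl hm)]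
      field_simp
      linear_combination 4 * g l * g m * w l * w m * (1 - w l) * (1 - w m) * h2
    rw [es]
    unfold foldCos
    field_simp
    ring
  rw [Compatible, ← sub_eq_zero, e, div_eq_zero_iff, or_iff_left (mul_ne_zero hl hm)]
  simp

theorem foldCos_injOn : Set.InjOn foldCos (Set.Icc 0 1) := by
  rintro v ⟨hv0, hv1⟩ w ⟨hw0, hw1⟩ h
  unfold foldCos at h
  rw [div_eq_div_iff (fold_denominator_pos v).ne' (fold_denominator_pos w).ne'] at h
  have h' : (v * (1 - w)) ^ 2 = (w * (1 - v)) ^ 2 := by linear_combination h / 4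
  rw [sq_eq_sq₀ (mul_nonneg hv0 (by linarith)) (mul_nonneg hw0 (by linarith))] at h'
  linarith

theorem foldSin_left_injective {w g g' : ℝ} (h0 : 0 < w) (h1 : w < 1)
    (h : foldSin g w = foldSin g' w) : g = g' := by
  refine mul_right_cancel₀ ?_ h
  have := fold_denominator_pos w
  have : 0 < 1 - w := by linarith
  positivity

theorem foldCos_zero : foldCos 0 = -1 := by norm_num [foldCos]
theorem foldCos_one : foldCos 1 = 1 := by norm_num [foldCos]
theorem foldSin_zero (g : ℝ) : foldSin g 0 = 0 := by norm_num [foldSin]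
theorem foldSin_one (g : ℝ) : foldSin g 1 = 0 := by norm_num [foldSin]

theorem continuous_foldCos : Continuous foldCos := by
  unfold foldCos
  exact Continuous.div (by fun_prop) (by fun_prop) fun w => (fold_denominator_pos w).ne'

theorem continuous_foldSin : Continuous fun p : ℝ × ℝ => foldSin p.1 p.2 := by
  unfold foldSin
  exact continuous_fst.mul
    (Continuous.div (by fun_prop) (by fun_prop) fun p => (fold_denominator_pos p.2).ne')

/-- The two signs. -/
def sign : Fin 2 → ℝ := ![1, -1]

theorem sign_sq (k : Fin 2) : sign k ^ 2 = 1 := by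
  fin_cases k <;> simp [sign]

theorem sign_injective : Function.Injective sign := by
  intro j k h
  fin_cases j <;> fin_cases k <;> first | rfl | (norm_num [sign] at h)

theorem exists_fold {c s : ℝ} (h : c ^ 2 + s ^ 2 = 1) :
    ∃ w ∈ Set.Icc (0 : ℝ) 1, ∃ k, c = foldCos w ∧ s = foldSin (sign k) w := by
  have hc0 : 0 ≤ 1 + c := by nlinarith [sq_nonneg s]
  have hc1 : 0 ≤ 1 - c := by nlinarith [sq_nonneg s]
  set a := √(1 + c) with ha
  set b := √(1 - c) with hb
  have ha2 : a ^ 2 = 1 + c := sq_sqrt hc0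
  have hb2 : b ^ 2 = 1 - c := sq_sqrt hc1
  have ha0 : 0 ≤ a := sqrt_nonneg _
  have hb0 : 0 ≤ b := sqrt_nonneg _
  have h2 : √2 ^ 2 = 2 := by norm_num
  have h20 : 0 < √2 := by positivity
  have hd : 0 < a + √2 * b := by
    by_contra! hd
    have := mul_nonneg h20.le hb0
    have ha' : a = 0 := by linarith
    have hb' : b = 0 := by nlinarith
    rw [ha'] at ha2
    rw [hb'] at hb2
    linarith
  -- Here `b / a` is the absolute half-angle tangent, and `w` solves `(1 - w) / (√2 w) = b / a`.
  set w := a / (a + √2 * b) with hw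
  have hw1 : 1 - w = √2 * b / (a + √2 * b) := by rw [hw]; field_simp; ring
  have hden : 2 * w ^ 2 + (1 - w) ^ 2 = 4 / (a + √2 * b) ^ 2 := by
    rw [hw1, hw, div_pow, div_pow, mul_pow, h2, ha2, hb2]; ring
  have hcos : c = foldCos w := by
    rw [foldCos, hden, hw1, hw, div_pow, div_pow, mul_pow, h2, ha2, hb2]
    field_simp
    ring
  have hab : (a * b) ^ 2 = s ^ 2 := by rw [mul_pow, ha2, hb2]; linarith
  have hsin (g : ℝ) : foldSin g w = g * (a * b) := by
    rw [foldSin, hden, hw1, hw]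
    field_simp
    linear_combination 2 * g * a * b * h2
  refine ⟨w, ⟨by positivity, ?_⟩, ?_⟩
  · have : 0 ≤ 1 - w := by rw [hw1]; positivity
    linarith
  · rcases sq_eq_sq_iff_eq_or_eq_neg.1 hab.symm with hs | hs
    · exact ⟨0, hcos, by rw [hsin, hs]; simp [sign]⟩
    · exact ⟨1, hcos, by rw [hsin, hs]; simp [sign]⟩

/-! ### Weights on the cells and their hexagons -/

/-- The barycentric coordinates of a point of a doubled edge. -/
def weight (ε : DoubledEdge) (t : ℝ) (l : Fin 4) : ℝ :=
  (1 - t) * (Pi.single ε.1.1.1 1 : Fin 4 → ℝ) l + t * (Pi.single ε.1.1.2 1 : Fin 4 → ℝ) l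

theorem weight_source (ε : DoubledEdge) (t : ℝ) : weight ε t ε.1.1.1 = 1 - t := by
  simp [weight, Pi.single_eq_of_ne ε.1.2.ne]

theorem weight_target (ε : DoubledEdge) (t : ℝ) : weight ε t ε.1.1.2 = t := by
  simp [weight, Pi.single_eq_of_ne ε.1.2.ne']

theorem weight_of_ne {ε : DoubledEdge} {l : Fin 4} (h₁ : l ≠ ε.1.1.1) (h₂ : l ≠ ε.1.1.2)
    (t : ℝ) : weight ε t l = 0 := by
  simp [weight, h₁, h₂]

theorem sum_weight (ε : DoubledEdge) (t : ℝ) : ∑ l, weight ε t l = 1 := by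
  simp [weight, Finset.sum_add_distrib, ← Finset.mul_sum]

theorem weight_mem_Icc (ε : DoubledEdge) (t : unitInterval) (l : Fin 4) :
    weight ε t l ∈ Set.Icc (0 : ℝ) 1 := by
  obtain ⟨t, h0, h1⟩ := t
  by_cases h₁ : l = ε.1.1.1
  · rw [h₁, weight_source]; constructor <;> linarith
  by_cases h₂ : l = ε.1.1.2
  · rw [h₂, weight_target]; exact ⟨h0, h1⟩
  · rw [weight_of_ne h₁ h₂]; simp

theorem weight_mul_eq_zero_or_add_eq_one (ε : DoubledEdge) (t : ℝ) {l m : Fin 4} (hlm : l ≠ m) :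
    weight ε t l * weight ε t m = 0 ∨ weight ε t l + weight ε t m = 1 := by
  by_cases h₁ : l = ε.1.1.1
  · by_cases h₂ : m = ε.1.1.2
    · right; rw [h₁, h₂, weight_source, weight_target]; ring
    · left; rw [weight_of_ne (l := m) (h₁ ▸ hlm.symm) h₂, mul_zero]
  by_cases h₂ : l = ε.1.1.2
  · by_cases h₃ : m = ε.1.1.1
    · right; rw [h₂, h₃, weight_source, weight_target]; ring
    · left; rw [weight_of_ne (l := m) h₃ (h₂ ▸ hlm.symm), mul_zero]
  · left; rw [weight_of_ne h₁ h₂, zero_mul]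

/-- The points of the doubled tetrahedron and the two extra points, before gluing. -/
abbrev Cells : Type := Fin 2 ⊕ (Fin 4 ⊕ (DoubledEdge × unitInterval))

/-- The sign with which a cell is folded. -/
def cellSign : Cells → ℝ :=
  Sum.elim sign (Sum.elim (fun _ => 1) fun p => sign p.1.2)

/-- The weights according to which a cell is folded. -/
def cellWeight : Cells → Fin 4 → ℝ :=
  Sum.elim (fun _ _ => 1 / 2) (Sum.elim (fun v => Pi.single v 1) fun p => weight p.1 p.2)

theorem continuous_cellSign : Continuous cellSign :=
  continuous_of_discreteTopology.sumElim (continuous_of_discreteTopology.sumElim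
    ((continuous_of_discreteTopology (f := sign)).comp (by fun_prop)))

theorem continuous_cellWeight : Continuous cellWeight := by
  refine continuous_of_discreteTopology.sumElim (continuous_of_discreteTopology.sumElim
    (continuous_pi fun l => ?_))
  have h₁ : Continuous fun ε : DoubledEdge => (Pi.single ε.1.1.1 1 : Fin 4 → ℝ) l :=
    continuous_of_discreteTopology
  have h₂ : Continuous fun ε : DoubledEdge => (Pi.single ε.1.1.2 1 : Fin 4 → ℝ) l :=
    continuous_of_discreteTopology
  have h₃ : Continuous fun p : DoubledEdge × unitInterval => (p.2 : ℝ) := by fun_prop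
  exact ((continuous_const.sub h₃).mul (h₁.comp continuous_fst)).add
    (h₃.mul (h₂.comp continuous_fst))

theorem cellSign_sq (x : Cells) : cellSign x ^ 2 = 1 := by
  rcases x with k | v | p
  · exact sign_sq k
  · exact one_pow 2
  · exact sign_sq p.1.2

theorem cellWeight_mul_eq_zero_or_add_eq_one (x : Cells) {l m : Fin 4} (hlm : l ≠ m) :
    cellWeight x l * cellWeight x m = 0 ∨ cellWeight x l + cellWeight x m = 1 := by
  rcases x with k | v | p
  · right; norm_num [cellWeight]
  · left
    rcases eq_or_ne l v with rfl | h
    · simp [cellWeight, hlm.symm]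
    · simp [cellWeight, h]
  · exact weight_mul_eq_zero_or_add_eq_one p.1 p.2 hlm

theorem cellWeight_mem_Icc (x : Cells) (l : Fin 4) : cellWeight x l ∈ Set.Icc (0 : ℝ) 1 := by
  rcases x with k | v | p
  · norm_num [cellWeight]
  · rcases eq_or_ne l v with rfl | h
    · simp [cellWeight]
    · simp [cellWeight, h]
  · exact weight_mem_Icc p.1 p.2 l

/-- The hexagon with the given weights and sign. -/
def foldedHexagon (g : ℝ) (w : Fin 4 → ℝ) : Fin 6 → Space :=
  bentHexagon (fun l => foldCos (w l)) fun l => foldSin g (w l)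

theorem foldedHexagon_mem_polygons (x : Cells) :
    foldedHexagon (cellSign x) (cellWeight x) ∈ polygons 6 (π / 3) := by
  have hg := cellSign_sq x
  rw [foldedHexagon, bentHexagon_mem_polygons_iff (foldCos_sq_add_foldSin_sq hg _)
    (foldCos_sq_add_foldSin_sq hg _) (foldCos_sq_add_foldSin_sq hg _)]
  have key {l m : Fin 4} (hlm : l ≠ m) : Compatible (fun i => foldCos (cellWeight x i))
      (fun i => foldSin (cellSign x) (cellWeight x i)) l m := by
    refine (compatible_fold_iff (g := fun _ => cellSign x)).2 ?_
    rcases cellWeight_mul_eq_zero_or_add_eq_one x hlm with h | h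
    · rw [h, zero_mul]
    · rw [← eq_sub_iff_add_eq] at h
      rw [h]
      linear_combination (1 - cellWeight x m) ^ 2 * cellWeight x m ^ 2 * hg
  exact ⟨key (by decide), key (by decide), key (by decide)⟩

theorem bentHexagon_congr {c s c' s' : Fin 4 → ℝ}
    (h : ∀ l ≠ 0, c l = c' l ∧ s l = s' l) : bentHexagon c s = bentHexagon c' s' := by
  unfold bentHexagon
  rw [(h 1 (by decide)).1, (h 1 (by decide)).2, (h 2 (by decide)).1, (h 2 (by decide)).2,
    (h 3 (by decide)).1, (h 3 (by decide)).2]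

theorem continuous_bentHexagon {X : Type*} [TopologicalSpace X] {c s : X → Fin 4 → ℝ}
    (hc : Continuous c) (hs : Continuous s) : Continuous fun x => bentHexagon (c x) (s x) := by
  refine continuous_pi fun i => ?_
  fin_cases i <;> simp [bentHexagon] <;> fun_prop

/-- The class of the folded hexagon of a cell. -/
def cellClass (x : Cells) : ConfigurationSpace 6 (π / 3) :=
  Quotient.mk _ ⟨foldedHexagon (cellSign x) (cellWeight x), foldedHexagon_mem_polygons x⟩

theorem continuous_cellClass : Continuous cellClass := by
  refine continuous_quotient_mk'.comp (Continuous.subtype_mk (continuous_bentHexagon ?_ ?_) _)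
  · exact continuous_pi fun l => continuous_foldCos.comp
      ((continuous_apply l).comp continuous_cellWeight)
  · exact continuous_pi fun l => continuous_foldSin.comp
      (continuous_cellSign.prodMk ((continuous_apply l).comp continuous_cellWeight))

theorem cellClass_congr {x y : Cells} (h : ∀ l ≠ 0, cellWeight x l = cellWeight y l ∧
    foldSin (cellSign x) (cellWeight x l) = foldSin (cellSign y) (cellWeight y l)) :
    cellClass x = cellClass y :=
  congrArg (Quotient.mk _) <| Subtype.ext <| bentHexagon_congr fun l hl =>
    ⟨congrArg foldCos (h l hl).1, (h l hl).2⟩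

theorem cellWeight_and_sin_eq_of_invariants_eq {x y : Cells}
    (h : invariants (cellClass x) = invariants (cellClass y)) {l : Fin 4} (hl : l ≠ 0) : cellWeight x l = cellWeight y l ∧
      foldSin (cellSign x) (cellWeight x l) = foldSin (cellSign y) (cellWeight y l) := by
  have hc : cosInvariant (foldedHexagon (cellSign x) (cellWeight x)) =
      cosInvariant (foldedHexagon (cellSign y) (cellWeight y)) :=
    congrArg Prod.fst h
  have hs : sinInvariant (foldedHexagon (cellSign x) (cellWeight x)) =
      sinInvariant (foldedHexagon (cellSign y) (cellWeight y)) :=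
    congrArg Prod.snd h
  replace hc := congrFun hc l
  replace hs := congrFun hs l
  unfold foldedHexagon at hc hs
  rw [cosInvariant_bentHexagon hl (foldCos_sq_add_foldSin_sq (cellSign_sq x) _),
    cosInvariant_bentHexagon hl (foldCos_sq_add_foldSin_sq (cellSign_sq y) _)] at hc
  rw [sinInvariant_bentHexagon _ _ hl, sinInvariant_bentHexagon _ _ hl] at hs
  exact ⟨foldCos_injOn (cellWeight_mem_Icc x l) (cellWeight_mem_Icc y l) hc, hs⟩

/-- At the ends of an edge all weights are `0` or `1`, so the sines vanish and the sign of the edge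
is forgotten. -/
theorem cellClass_eq_of_glue {a b : Fin 4 ⊕ (DoubledEdge × unitInterval)} (h : Glue a b) :
    cellClass (Sum.inr a) = cellClass (Sum.inr b) := by
  have key (g g' : ℝ) (v : Fin 4) (l : Fin 4) :
      foldSin g ((Pi.single v 1 : Fin 4 → ℝ) l) = foldSin g' ((Pi.single v 1 : Fin 4 → ℝ) l) := by
    rcases eq_or_ne l v with rfl | h
    · simp only [Pi.single_eq_same, foldSin_one]
    · simp only [Pi.single_eq_of_ne h, foldSin_zero]
  rcases h with ε | ε
  · have hw : cellWeight (Sum.inr (Sum.inr (ε, 0))) = cellWeight (Sum.inr (Sum.inl ε.1.1.1)) := by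
      ext l
      simp [cellWeight, weight]
    refine cellClass_congr fun l _ => ⟨congrFun hw l, ?_⟩
    rw [hw]
    exact key _ _ _ _
  · have hw : cellWeight (Sum.inr (Sum.inr (ε, 1))) = cellWeight (Sum.inr (Sum.inl ε.1.1.2)) := by
      ext l
      simp [cellWeight, weight]
    refine cellClass_congr fun l _ => ⟨congrFun hw l, ?_⟩
    rw [hw]
    exact key _ _ _ _

/-! ### The parametrization and its injectivity -/

/-- The parametrization of the configuration space. -/
def parametrization : Fin 2 ⊕ DoubledTetrahedron → ConfigurationSpace 6 (π / 3) :=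
  Sum.elim (fun k => cellClass (Sum.inl k))
    (Quot.lift (fun a => cellClass (Sum.inr a)) fun _ _ => cellClass_eq_of_glue)

theorem continuous_parametrization : Continuous parametrization :=
  continuous_of_discreteTopology.sumElim
    (continuous_quot_lift _ (continuous_cellClass.comp continuous_inr))

/-- The point of the doubled tetrahedron at position `t` of an edge. -/
def edgePoint (ε : DoubledEdge) (t : unitInterval) : DoubledTetrahedron :=
  Quot.mk Glue (Sum.inr (ε, t))

theorem eq_vertex_or_eq_edgePoint (x : DoubledTetrahedron) :
    (∃ v, x = DoubledTetrahedron.vertex v) ∨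
      ∃ ε, ∃ t : unitInterval, 0 < (t : ℝ) ∧ (t : ℝ) < 1 ∧ x = edgePoint ε t := by
  rcases x with ⟨v | ⟨ε, t⟩⟩
  · exact Or.inl ⟨v, rfl⟩
  rcases eq_or_ne t 0 with rfl | h0
  · exact Or.inl ⟨_, Quot.sound (Glue.source ε)⟩
  rcases eq_or_ne t 1 with rfl | h1
  · exact Or.inl ⟨_, Quot.sound (Glue.target ε)⟩
  · exact Or.inr ⟨ε, t, unitInterval.pos_iff_ne_zero.2 h0, unitInterval.lt_one_iff_ne_one.2 h1, rfl⟩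

theorem sum_cellWeight (a : Fin 4 ⊕ (DoubledEdge × unitInterval)) :
    ∑ l, cellWeight (Sum.inr a) l = 1 := by
  rcases a with v | p
  · simp [cellWeight]
  · exact sum_weight p.1 p.2

/-- The invariants determine the weights `1, 2, 3`; the weight `0` follows because the sum is one.
-/
theorem cellWeight_eq_of_invariants_eq {a b : Fin 4 ⊕ (DoubledEdge × unitInterval)}
    (h : invariants (cellClass (Sum.inr a)) = invariants (cellClass (Sum.inr b))) :
    cellWeight (Sum.inr a) = cellWeight (Sum.inr b) := by
  have ha := sum_cellWeight a
  have hb := sum_cellWeight b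
  have hl {l : Fin 4} (hl : l ≠ 0) := (cellWeight_and_sin_eq_of_invariants_eq h hl).1
  rw [Fin.sum_univ_four] at ha hb
  ext l
  by_cases h0 : l = 0
  · rw [h0]
    linarith [hl (l := 1) (by decide), hl (l := 2) (by decide), hl (l := 3) (by decide)]
  · exact hl h0

theorem invariants_cellClass_inl_injective :
    Function.Injective fun k => invariants (cellClass (Sum.inl k)) := by
  intro j k h
  have := (cellWeight_and_sin_eq_of_invariants_eq h (l := 1) (by decide)).2
  exact sign_injective (foldSin_left_injective (w := 1 / 2) (by norm_num) (by norm_num) this)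

theorem invariants_cellClass_inl_ne_inr (k : Fin 2) (a : Fin 4 ⊕ (DoubledEdge × unitInterval)) :
    invariants (cellClass (Sum.inl k)) ≠ invariants (cellClass (Sum.inr a)) := by
  intro h
  have ha := sum_cellWeight a
  have h0 := (cellWeight_mem_Icc (Sum.inr a) 0).1
  have hl {l : Fin 4} (hl : l ≠ 0) : (1 / 2 : ℝ) = cellWeight (Sum.inr a) l :=
    (cellWeight_and_sin_eq_of_invariants_eq h hl).1
  rw [Fin.sum_univ_four] at ha
  -- Three weights `1 / 2` already exceed the total weight one.
  linarith [hl (l := 1) (by decide), hl (l := 2) (by decide), hl (l := 3) (by decide)]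

theorem single_ne_weight {v : Fin 4} {ε : DoubledEdge} {t : ℝ} (h0 : 0 < t) (h1 : t < 1) :
    (Pi.single v 1 : Fin 4 → ℝ) ≠ weight ε t := by
  intro h
  have ht := congrFun h ε.1.1.2
  rw [weight_target] at ht
  rcases eq_or_ne ε.1.1.2 v with hv | hv
  · rw [hv, Pi.single_eq_same] at ht
    linarith
  · rw [Pi.single_eq_of_ne hv] at ht
    linarith

theorem eq_or_eq_of_weight_ne_zero {ε : DoubledEdge} {t : ℝ} {l : Fin 4} (h : weight ε t l ≠ 0) :
    l = ε.1.1.1 ∨ l = ε.1.1.2 := by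
  by_contra! hc
  exact h (weight_of_ne hc.1 hc.2 t)

theorem edge_eq_of_weight_eq {ε δ : DoubledEdge} {t u : ℝ} (h0 : 0 < t) (h1 : t < 1)
    (h : weight ε t = weight δ u) : ε.1 = δ.1 := by
  have hs : weight δ u ε.1.1.1 ≠ 0 := by rw [← h, weight_source]; linarith
  have ht : weight δ u ε.1.1.2 ≠ 0 := by rw [← h, weight_target]; linarith
  have hε := ε.1.2
  have hδ := δ.1.2
  refine Subtype.ext (Prod.ext ?_ ?_) <;>
    rcases eq_or_eq_of_weight_ne_zero hs with e₁ | e₁ <;>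
    rcases eq_or_eq_of_weight_ne_zero ht with e₂ | e₂ <;> omega

theorem invariants_parametrization_inr_injective :
    Function.Injective fun x => invariants (parametrization (Sum.inr x)) := by
  intro x y h
  rcases eq_vertex_or_eq_edgePoint x with ⟨v, rfl⟩ | ⟨ε, t, ht0, ht1, rfl⟩ <;>
    rcases eq_vertex_or_eq_edgePoint y with ⟨v', rfl⟩ | ⟨δ, u, hu0, hu1, rfl⟩
  · have hw : (Pi.single v 1 : Fin 4 → ℝ) = Pi.single v' 1 := cellWeight_eq_of_invariants_eq h
    by_cases hv : v = v'
    · rw [hv]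
    · simpa [hv] using congrFun hw v
  · exact absurd (cellWeight_eq_of_invariants_eq h) (single_ne_weight hu0 hu1)
  · exact absurd (cellWeight_eq_of_invariants_eq h).symm (single_ne_weight ht0 ht1)
  · have hw : weight ε t = weight δ u := cellWeight_eq_of_invariants_eq h
    have hε : ε.1 = δ.1 := edge_eq_of_weight_eq ht0 ht1 hw
    have htu : (t : ℝ) = u := by
      have := congrFun hw ε.1.1.2
      rw [weight_target, hε, weight_target] at this
      exact this
    -- The sign is read off at the larger end, since the smaller one may be `0`, which has no fold
    -- angle.
    have hne : ε.1.1.2 ≠ 0 := ((Fin.zero_le _).trans_lt ε.1.2).ne'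
    have hs : foldSin (sign ε.2) (weight ε t ε.1.1.2) = foldSin (sign δ.2) (weight δ u ε.1.1.2) :=
      (cellWeight_and_sin_eq_of_invariants_eq h hne).2
    rw [← hw, weight_target] at hs
    rw [Subtype.ext htu, Prod.ext hε (sign_injective (foldSin_left_injective ht0 ht1 hs))]

theorem invariants_comp_parametrization_injective :
    Function.Injective (invariants ∘ parametrization) := by
  rintro (j | x) (k | y) h
  · rw [invariants_cellClass_inl_injective h]
  · obtain ⟨b, rfl⟩ := Quot.exists_rep y
    exact absurd h (invariants_cellClass_inl_ne_inr j b)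
  · obtain ⟨a, rfl⟩ := Quot.exists_rep x
    exact absurd h.symm (invariants_cellClass_inl_ne_inr k a)
  · rw [invariants_parametrization_inr_injective h]

theorem exists_parametrization_eq_cellClass (x : Cells) : ∃ y, parametrization y = cellClass x := by
  rcases x with k | a
  · exact ⟨Sum.inl k, rfl⟩
  · exact ⟨Sum.inr (Quot.mk _ a), rfl⟩

/-! ### Surjectivity -/

theorem exists_cell_of_subset_singleton {w : Fin 4 → ℝ} {k : Fin 4 → Fin 2}
    (hw : ∀ l, w l ∈ Set.Icc (0 : ℝ) 1) {l : Fin 4} (hl : l ≠ 0)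
    (h : ∀ n, n ≠ 0 → n ≠ l → w n = 0) :
    ∃ x : Cells, ∀ n ≠ 0, w n = cellWeight x n ∧ (w n ≠ 0 → sign (k n) = cellSign x) := by
  let ε : DoubledEdge := (⟨(0, l), Fin.pos_iff_ne_zero.2 hl⟩, k l)
  refine ⟨Sum.inr (Sum.inr (ε, ⟨w l, hw l⟩)), fun n hn => ?_⟩
  change w n = weight ε (w l) n ∧ (w n ≠ 0 → sign (k n) = sign (k l))
  by_cases hnl : n = l
  · rw [hnl]
    exact ⟨(weight_target ε _).symm, fun _ => rfl⟩
  · rw [h n hn hnl, weight_of_ne (ε := ε) hn hnl]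
    simp

theorem exists_cell_of_subset_pair {w : Fin 4 → ℝ} {k : Fin 4 → Fin 2}
    (hw : ∀ l, w l ∈ Set.Icc (0 : ℝ) 1) {l m : Fin 4} (hlm : l < m)
    (hk : k l = k m) (hs : w l + w m = 1) (h : ∀ n, n ≠ 0 → n ≠ l → n ≠ m → w n = 0) :
    ∃ x : Cells, ∀ n ≠ 0, w n = cellWeight x n ∧ (w n ≠ 0 → sign (k n) = cellSign x) := by
  let ε : DoubledEdge := (⟨(l, m), hlm⟩, k l)
  refine ⟨Sum.inr (Sum.inr (ε, ⟨w m, hw m⟩)), fun n hn => ?_⟩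
  change w n = weight ε (w m) n ∧ (w n ≠ 0 → sign (k n) = sign (k l))
  by_cases hnl : n = l
  · rw [hnl]
    exact ⟨(eq_sub_of_add_eq hs).trans (weight_source ε _).symm, fun _ => rfl⟩
  by_cases hnm : n = m
  · rw [hnm, hk]
    exact ⟨(weight_target ε _).symm, fun _ => rfl⟩
  · rw [h n hn hnl hnm, weight_of_ne (ε := ε) hnl hnm]
    simp

/-- The number of nonzero weights among `1, 2, 3` decides: three give an isolated point, two an edge
between their indices, at most one an edge from `0`. Signs matter only at nonzero weights. -/
theorem exists_cell_of_compatible {w : Fin 4 → ℝ} {k : Fin 4 → Fin 2}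
    (hw : ∀ l, w l ∈ Set.Icc (0 : ℝ) 1)
    (h : ∀ l m, l ≠ 0 → m ≠ 0 → l ≠ m → w l = 0 ∨ w m = 0 ∨ (k l = k m ∧ w l + w m = 1)) :
    ∃ x : Cells, ∀ l ≠ 0, w l = cellWeight x l ∧ (w l ≠ 0 → sign (k l) = cellSign x) := by
  by_cases hpair : ∃ l m, l ≠ 0 ∧ l < m ∧ w l ≠ 0 ∧ w m ≠ 0
  · obtain ⟨l, m, hl, hlm, hwl, hwm⟩ := hpair
    have hm : m ≠ 0 := ((Fin.zero_le _).trans_lt hlm).ne'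
    obtain ⟨hk, hs⟩ := ((h l m hl hm hlm.ne).resolve_left hwl).resolve_left hwm
    by_cases hthird : ∃ n, n ≠ 0 ∧ n ≠ l ∧ n ≠ m ∧ w n ≠ 0
    · obtain ⟨n, hn, hnl, hnm, hwn⟩ := hthird
      obtain ⟨hk', hs'⟩ := ((h n l hn hl hnl).resolve_left hwn).resolve_left hwl
      obtain ⟨-, hs''⟩ := ((h n m hn hm hnm).resolve_left hwn).resolve_left hwm
      have hall (i : Fin 4) (hi : i ≠ 0) : i = l ∨ i = m ∨ i = n := by omega
      refine ⟨Sum.inl (k l), fun i hi => ?_⟩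
      change w i = 1 / 2 ∧ (w i ≠ 0 → sign (k i) = sign (k l))
      rcases hall i hi with rfl | rfl | rfl
      · exact ⟨by linarith, fun _ => rfl⟩
      · exact ⟨by linarith, fun _ => by rw [hk]⟩
      · exact ⟨by linarith, fun _ => by rw [hk']⟩
    · push Not at hthird
      exact exists_cell_of_subset_pair hw hlm hk hs hthird
  · push Not at hpair
    by_cases hone : ∃ l, l ≠ 0 ∧ w l ≠ 0
    · obtain ⟨l, hl, hwl⟩ := hone
      refine exists_cell_of_subset_singleton hw hl fun n hn hnl => ?_
      by_contra hwn
      rcases lt_or_gt_of_ne hnl with hlt | hlt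
      · exact hwl (hpair n l hn hlt hwn)
      · exact hwn (hpair l n hl hlt hwl)
    · push Not at hone
      exact exists_cell_of_subset_singleton hw one_ne_zero fun n hn _ => hone n hn

theorem compatible_weights {w : Fin 4 → ℝ} {k : Fin 4 → Fin 2}
    (hw : ∀ l, w l ∈ Set.Icc (0 : ℝ) 1) {l m : Fin 4}
    (h : Compatible (fun i => foldCos (w i)) (fun i => foldSin (sign (k i)) (w i)) l m) :
    w l = 0 ∨ w m = 0 ∨ (k l = k m ∧ w l + w m = 1) := by
  rw [compatible_fold_iff (g := fun i => sign (k i)), mul_eq_zero, mul_eq_zero, or_assoc] at h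
  refine or_iff_not_imp_left.2 fun hl => or_iff_not_imp_left.2 fun hm => ?_
  replace h := (h.resolve_left hl).resolve_left hm
  have hl0 := (hw l).1.lt_of_ne' hl
  have hm0 := (hw m).1.lt_of_ne' hm
  have hl1 := (hw l).2
  have hm1 := (hw m).2
  have hp := mul_pos hl0 hm0
  have hq := mul_nonneg (sub_nonneg.2 hl1) (sub_nonneg.2 hm1)
  generalize k l = i at *
  generalize k m = j at *
  -- Opposite signs would equate a nonpositive number with `w l * w m > 0`; equal signs leave `1 - w
  -- l - w m = 0`.
  fin_cases i <;> fin_cases j <;> simp [sign] at h ⊢ <;> nlinarith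

theorem parametrization_surjective : Function.Surjective parametrization := by
  intro z
  obtain ⟨⟨P, hP⟩, rfl⟩ := Quotient.exists_rep z
  obtain ⟨c, s, hcs, g, hg, hgP⟩ := exists_motion_eq_bentHexagon hP
  choose w hw k hc hs using fun l => exists_fold (hcs l)
  have hmem : bentHexagon c s ∈ polygons 6 (π / 3) := by
    rw [mem_polygons_iff] at hP ⊢
    simpa only [← hgP, g.dist_map] using hP
  obtain ⟨h12, h13, h23⟩ := (bentHexagon_mem_polygons_iff (hcs 1) (hcs 2) (hcs 3)).1 hmem
  obtain rfl : c = fun l => foldCos (w l) := funext hc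
  obtain rfl : s = fun l => foldSin (sign (k l)) (w l) := funext hs
  have h12' := compatible_weights hw h12
  have h13' := compatible_weights hw h13
  have h23' := compatible_weights hw h23
  obtain ⟨x, hx⟩ := exists_cell_of_compatible (w := w) (k := k) hw (by
    have hsymm {l m : Fin 4} (h : w l = 0 ∨ w m = 0 ∨ (k l = k m ∧ w l + w m = 1)) :
        w m = 0 ∨ w l = 0 ∨ (k m = k l ∧ w m + w l = 1) := by
      rw [add_comm (w m), eq_comm (a := k m)]
      tauto
    intro l m hl hm hlm
    fin_cases l <;> fin_cases m <;> first
      | exact absurd rfl hl | exact absurd rfl hm | exact absurd rfl hlm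
      | assumption | (apply hsymm; assumption))
  obtain ⟨y, hy⟩ := exists_parametrization_eq_cellClass x
  refine ⟨y, hy.trans (Quotient.sound (Setoid.symm' _ ⟨g, hg, fun i => ?_⟩))⟩
  rw [hgP]
  change _ = foldedHexagon (cellSign x) (cellWeight x) i
  unfold foldedHexagon
  refine congrFun (bentHexagon_congr fun l hl => ⟨congrArg foldCos (hx l hl).1, ?_⟩) i
  rw [← (hx l hl).1]
  by_cases h0 : w l = 0
  · rw [h0, foldSin_zero, foldSin_zero]
  · rw [(hx l hl).2 h0]

theorem parametrization_bijective : Function.Bijective parametrization :=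
  ⟨invariants_comp_parametrization_injective.of_comp, parametrization_surjective⟩

/-! ### The homeomorphism -/

instance : T2Space (ConfigurationSpace 6 (π / 3)) :=
  T2Space.of_injective_continuous
    (invariants_comp_parametrization_injective.of_comp_right parametrization_surjective)
    continuous_invariants

instance : CompactSpace DoubledTetrahedron :=
  inferInstanceAs (CompactSpace (Quot Glue))

/-- The configuration space of `π / 3`-equiangular hexagons is the sum of two points and the
doubled tetrahedron. -/
def configurationHomeomorph :
    Fin 2 ⊕ DoubledTetrahedron ≃ₜ ConfigurationSpace 6 (π / 3) :=
  Continuous.homeoOfEquivCompactToT2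
    (f := Equiv.ofBijective parametrization parametrization_bijective) continuous_parametrization

/-! ### The chairs and the planar hexagons -/

theorem isClassOf_cellClass {x : Cells} {P : Fin 6 → Space}
    (h : P = foldedHexagon (cellSign x) (cellWeight x)) : IsClassOf (cellClass x) P := by
  subst h
  exact ⟨foldedHexagon_mem_polygons x, rfl⟩

theorem chair_eq_foldedHexagon : chair = foldedHexagon 1 fun _ => 1 / 2 := by
  have hc : cos (arccos (1 / 3)) = foldCos (1 / 2) := by
    rw [cos_arccos (by norm_num) (by norm_num)]
    norm_num [foldCos]
  have hs : sin (arccos (1 / 3)) = foldSin 1 (1 / 2) := by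
    have h2 : √2 ^ 2 = 2 := by norm_num
    have h0 : 0 ≤ foldSin 1 (1 / 2) := by unfold foldSin; positivity
    rw [sin_arccos, ← sqrt_sq h0]
    norm_num [foldSin, mul_pow, div_pow]
  exact hexagon_eq_bentHexagon hc hc hc hs hs hs

theorem mirrorImage_bentHexagon (c s : Fin 4 → ℝ) :
    mirrorImage (bentHexagon c s) = bentHexagon c fun l => -s l := by
  ext i j
  fin_cases i <;> fin_cases j <;> simp [mirrorImage, bentHexagon]

theorem mirrorImage_chair_eq_foldedHexagon :
    mirrorImage chair = foldedHexagon (-1) fun _ => 1 / 2 := by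
  rw [chair_eq_foldedHexagon, foldedHexagon, mirrorImage_bentHexagon, foldedHexagon]
  simp only [foldSin, neg_one_mul, one_mul]

/-- Weight `0` is fold angle `π` and weight `1` is fold angle `0`; the order `5, 1, 3` in `apex`
matches that of the list of planar hexagons. -/
theorem planarHexagon_eq_foldedHexagon (v : Fin 4) :
    planarHexagon v = foldedHexagon 1 (Pi.single v 1) := by
  fin_cases v <;>
    exact hexagon_eq_bentHexagon (by simp [foldCos_zero, foldCos_one])
      (by simp [foldCos_zero, foldCos_one]) (by simp [foldCos_zero, foldCos_one])
      (by simp [foldSin_zero, foldSin_one]) (by simp [foldSin_zero, foldSin_one])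
      (by simp [foldSin_zero, foldSin_one])

theorem coplanar_planarHexagon (v : Fin 4) : Coplanar ℝ (Set.range (planarHexagon v)) := by
  refine coplanar_of_third_coordinate_eq_zero ?_
  rintro _ ⟨i, rfl⟩
  fin_cases v <;> fin_cases i <;> simp [planarHexagon, hexagon]

end Hexagons

end

theorem mainTheorem5 :
    ∃ e : Hexagons.ConfigurationSpace 6 (Real.pi / 3) ≃ₜ Fin 2 ⊕ Hexagons.DoubledTetrahedron,
      Hexagons.IsClassOf (e.symm (Sum.inl 0)) Hexagons.chair ∧
      Hexagons.IsClassOf (e.symm (Sum.inl 1)) (Hexagons.mirrorImage Hexagons.chair) ∧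
      ∀ v : Fin 4,
        Hexagons.IsClassOf (e.symm (Sum.inr (Hexagons.DoubledTetrahedron.vertex v)))
          (Hexagons.planarHexagon v) ∧
        Coplanar ℝ (Set.range (Hexagons.planarHexagon v)) := by
  refine ⟨Hexagons.configurationHomeomorph.symm,
    Hexagons.isClassOf_cellClass (x := Sum.inl 0) Hexagons.chair_eq_foldedHexagon,
    Hexagons.isClassOf_cellClass (x := Sum.inl 1) Hexagons.mirrorImage_chair_eq_foldedHexagon,
    fun v => ⟨Hexagons.isClassOf_cellClass (x := Sum.inr (Sum.inl v))
      (Hexagons.planarHexagon_eq_foldedHexagon v), Hexagons.coplanar_planarHexagon v⟩⟩
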